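/- Let $G$ be a finite graph, possibly with loops and multiple edges, with vertex set $V$, $|V|=n$, and edges enumerated as $e_1,\dots,e_m$. A *state* of $G$ is a subset $F\subseteq E(G)$, regarded as a spanning subgraph. For $b\ge 1$ let $\mathcal L_b=\bigoplus_{i=0}^{b-1}\mathcal S^{(b-i,1^i)}\cong\bigwedge^*\mathcal S^{(b-1,1)}$, a graded complex $\mathfrak S_b$-module with $\mathcal S^{(b-i,1^i)}\cong\bigwedge^i\mathcal S^{(b-1,1)}$ in degree $i$, where $\mathcal S^{(b-1,1)}$ is the module of vectors of coordinate sum $0$ in $\mathbb C^b$. If the connected components of $F$ are $B_1,\dots,B_r$, of sizes $b_1,\dots,b_r$, let $$\mathcal M_F=\mathrm{Ind}_{\mathfrak S_{B_1}\times\cdots\times\mathfrak S_{B_r}}^{\mathfrak S_V}\bigl(\mathcal L_{b_1}\otimes\cdots\otimes\mathcal L_{b_r}\bigr),\qquad \mathcal L_{b_1}\otimes\cdots\otimes\mathcal L_{b_r}=\bigwedge\nolimits^{*}\bigl(\mathcal S^{(b_1-1,1)}\oplus\cdots\oplus\mathcal S^{(b_r-1,1)}\bigr),$$ graded by exterior degree.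 For $e\in F$ define the per-edge map $d_{F,e}:\mathcal M_F\to\mathcal M_{F-e}$ as follows. If the ends of $e$ lie in the same component of $F-e$, then $\mathcal M_F=\mathcal M_{F-e}$ and $d_{F,e}$ is the identity. If removing $e$ splits the component $B_r$ into $A$ and $B$ of sizes $a$ and $b$, then $\mathcal S^{(a+b-1,1)}$ restricted to $\mathfrak S_A\times\mathfrak S_B$ is $\mathcal T\oplus\mathbf 1$ with $\mathcal T=\mathcal S^{(a-1,1)}\oplus\mathcal S^{(b-1,1)}$, so that $\mathcal L_{a+b}$ restricts to $\bigwedge^*\mathcal T\oplus(\bigwedge^*\mathcal T)[1]$; let $d_\zeta:\mathcal L_{a+b}\to\mathrm{Ind}_{\mathfrak S_A\times\mathfrak S_B}^{\mathfrak S_{B_r}}(\mathcal L_a\otimes\mathcal L_b)$ be the map that corresponds under Frobenius reciprocity to the identity on $\bigwedge^*\mathcal T$ and zero on $(\bigwedge^*\mathcal T)[1]$, and let $d_{F,e}$ be induced from $\mathrm{id}_{\mathcal L_{b_1}\otimes\cdots\otimes\mathcal L_{b_{r-1}}}\otimes d_\zeta$. For $i,j\ge 0$ put $C_{i,j}(G)=\bigoplus_{|F|=i}(\mathcal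 M_F)_j$, and let $d_{i,j}:C_{i,j}(G)\to C_{i-1,j}(G)$ be the sum of the maps $(-1)^{k(F,e)}d_{F,e}$ over all states $F$ with $i$ edges and all $e\in F$, where $k(F,e)$ is the number of edges that come after $e$ in the enumeration and do not belong to $F$. Then $d_{i,j}\circ d_{i+1,j}=0$, and the *chromatic symmetric homology* of $G$ consists of the $\mathfrak S_n$-modules $H_{i,j}(G)=\ker d_{i,j}/\operatorname{im} d_{i+1,j}$, with $H_*(G)=\bigoplus_{i,j\ge0}H_{i,j}(G)$. **Proposition.** If $G$ contains a loop, then $H_*(G)=0$; that is, $H_{i,j}(G)=0$ for all $i,j\ge 0$. -/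

import Mathlib

open scoped Graph

noncomputable section

namespace ChromaticSymmetric

universe u v

set_option linter.unusedSectionVars false

/-! Multigraphs (loops and multiple edges allowed) are Mathlib's `Graph`.  Throughout, the vertex
set `V(G)` and the edge set `E(G)` are finite, and the linear order on `E(G)` is the enumeration
`e₁, …, e_m` of the edges.  A state is a spanning subgraph, given by its edge set
`F : Finset E(G)`. -/

section Components

variable {α : Type u} {β : Type v} (G : Graph α β) [Fintype V(G)]

/-- Two vertices are related if they lie in the same connected component of the state `F`. -/
def conn (F : Finset E(G)) : Setoid V(G) :=
  Relation.EqvGen.setoid fun a b => ∃ e ∈ F, G.IsLink (e : β) (a : α) (b : α)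

open Classical in
/-- The (vertex set of the) connected component of the vertex `a` in the state `F`. -/
def comp (F : Finset E(G)) (a : V(G)) : Finset V(G) :=
  Finset.univ.filter fun b => conn G F a b

variable {G}

theorem mem_comp {F : Finset E(G)} {a b : V(G)} : b ∈ comp G F a ↔ conn G F a b := by
  simp [comp]

theorem self_mem_comp (F : Finset E(G)) (a : V(G)) : a ∈ comp G F a :=
  mem_comp.2 ((conn G F).refl a)

theorem comp_eq {F : Finset E(G)} {a b : V(G)} (h : conn G F a b) : comp G F a = comp G F b := by
  ext c
  rw [mem_comp, mem_comp]
  exact ⟨fun hc => (conn G F).trans ((conn G F).symm h) hc, fun hc => (conn G F).trans h hc⟩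

theorem conn_mono {F F' : Finset E(G)} (h : F' ⊆ F) {a b : V(G)} (hab : conn G F' a b) :
    conn G F a b :=
  Relation.EqvGen.mono (fun _ _ ⟨e, he, hl⟩ => ⟨e, h he, hl⟩) _ _ hab

theorem comp_mono {F F' : Finset E(G)} (h : F' ⊆ F) (a : V(G)) : comp G F' a ⊆ comp G F a :=
  fun _ hb => mem_comp.2 (conn_mono h (mem_comp.1 hb))

variable (G)

/-- The Young subgroup `𝔖_{B₁} × ⋯ × 𝔖_{B_r}` of the symmetric group on `V(G)`, where
`B₁, …, B_r` are the connected components of the state `F`. -/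
def young (F : Finset E(G)) : Subgroup (Equiv.Perm V(G)) where
  carrier := {σ | ∀ a, conn G F a (σ a)}
  one_mem' a := (conn G F).refl a
  mul_mem' {σ τ} hσ hτ a := (conn G F).trans (hτ a) (hσ (τ a))
  inv_mem' {σ} hσ a := by
    have h := hσ (σ⁻¹ a)
    rw [← Equiv.Perm.mul_apply, mul_inv_cancel, Equiv.Perm.one_apply] at h
    exact (conn G F).symm h

variable {G}

theorem young_mono {F F' : Finset E(G)} (h : F' ⊆ F) : young G F' ≤ young G F :=
  fun _ hσ a => conn_mono h (hσ a)

/-- Reindexing a sum over a component by an element of the Young subgroup. -/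
theorem sum_comp_young {F : Finset E(G)} {σ : Equiv.Perm V(G)} (hσ : σ ∈ young G F)
    (x : V(G) → ℂ) (a : V(G)) :
    ∑ b ∈ comp G F a, x (σ b) = ∑ b ∈ comp G F a, x b := by
  refine Finset.sum_equiv σ (fun b => ?_) (fun _ _ => rfl)
  rw [mem_comp, mem_comp]
  exact ⟨fun h => (conn G F).trans h (hσ b), fun h => (conn G F).trans h ((conn G F).symm (hσ b))⟩

end Components

section Modules

variable {α : Type u} {β : Type v} (G : Graph α β) [Fintype V(G)]

/-- The direct sum `𝒮^{(b₁-1,1)} ⊕ ⋯ ⊕ 𝒮^{(b_r-1,1)}` of the standard representations of the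
symmetric groups of the components `B₁, …, B_r` of `F`, where `𝒮^{(b-1,1)}` is realised as the
vectors of coordinate sum zero in `ℂ^B`: the vectors in `ℂ^{V(G)} = ⨁ ℂ^{B_k}` whose
coordinates sum to zero over each component.  The summand of a one-vertex component is `0`. -/
def std (F : Finset E(G)) : Submodule ℂ (V(G) → ℂ) where
  carrier := {x | ∀ a, ∑ b ∈ comp G F a, x b = 0}
  zero_mem' := by simp
  add_mem' {x y} hx hy a := by
    simp only [Pi.add_apply, Finset.sum_add_distrib, hx a, hy a, add_zero]
  smul_mem' c x hx a := by
    simp only [Pi.smul_apply, ← Finset.smul_sum, hx a, smul_zero]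

/-- The Young subgroup permutes coordinates: `(σ x)_a = x_{σ⁻¹ a}`. -/
def stdRep (F : Finset E(G)) : Representation ℂ (young G F) (std G F) where
  toFun σ := (LinearMap.funLeft ℂ ℂ ((σ⁻¹ : young G F) : Equiv.Perm V(G))).restrict
    fun x hx a => (sum_comp_young (σ⁻¹).2 x a).trans (hx a)
  map_one' := by ext; simp
  map_mul' σ τ := by ext; simp

/-- The degree `j` part of the graded module `ℒ_{b₁} ⊗ ⋯ ⊗ ℒ_{b_r}` over the Young subgroup of
`F`.  Here `ℒ_b = ⨁ᵢ 𝒮^{(b-i,1^i)}` is the exterior algebra `⋀^* 𝒮^{(b-1,1)}`, with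
`𝒮^{(b-i,1^i)} = ⋀^i 𝒮^{(b-1,1)}` in degree `i`, and the tensor product of the exterior algebras
is the exterior algebra of the direct sum of the `𝒮^{(b_k-1,1)}`. -/
abbrev extModule (F : Finset E(G)) (j : ℕ) : Type u := ⋀[ℂ]^j (std G F)

/-- The action of the Young subgroup on `extModule G F j`, induced from `stdRep G F`. -/
def extRep (F : Finset E(G)) (j : ℕ) : Representation ℂ (young G F) (extModule G F j) where
  toFun σ := exteriorPower.map j (stdRep G F σ)
  map_one' := by rw [map_one]; exact exteriorPower.map_id
  map_mul' σ τ := by rw [map_mul]; exact exteriorPower.map_comp _ _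

/-- The underlying space `(ℳ_F)_j` of the degree `j` part of
`ℳ_F = Ind (ℒ_{b₁} ⊗ ⋯ ⊗ ℒ_{b_r})`, the induction being from the Young subgroup of `F` to the
symmetric group on `V(G)`.  The groups are finite, so the induced module is realised as
the module of equivariant functions on the big group. -/
abbrev stateModule (F : Finset E(G)) (j : ℕ) : Type u :=
  Representation.coindV (young G F).subtype (extRep G F j)

/-- The action of the symmetric group on `V(G)` on `(ℳ_F)_j`. -/
abbrev stateRep (F : Finset E(G)) (j : ℕ) :
    Representation ℂ (Equiv.Perm V(G)) (stateModule G F j) :=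
  Representation.coind (young G F).subtype (extRep G F j)

end Modules

section PerEdge

variable {α : Type u} {β : Type v} (G : Graph α β) [Fintype V(G)]

/-- Subtracting from a vector its mean on each component of `F`.  This is the
projection of `ℂ^{V(G)}` onto `std G F` along the vectors constant on the components of `F`. -/
def center (F : Finset E(G)) : (V(G) → ℂ) →ₗ[ℂ] (V(G) → ℂ) where
  toFun x a := x a - ((comp G F a).card : ℂ)⁻¹ * ∑ b ∈ comp G F a, x b
  map_add' x y := by
    ext a; simp only [Pi.add_apply, Finset.sum_add_distrib]; ring
  map_smul' c x := by
    ext a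
    simp only [Pi.smul_apply, smul_eq_mul, ← Finset.mul_sum, RingHom.id_apply]; ring

variable {G}

theorem center_apply (F : Finset E(G)) (x : V(G) → ℂ) (a : V(G)) :
    center G F x a = x a - ((comp G F a).card : ℂ)⁻¹ * ∑ b ∈ comp G F a, x b := rfl

theorem card_comp_ne_zero (F : Finset E(G)) (a : V(G)) : ((comp G F a).card : ℂ) ≠ 0 :=
  Nat.cast_ne_zero.2 (Finset.card_ne_zero_of_mem (self_mem_comp F a))

theorem center_mem (F : Finset E(G)) (x : V(G) → ℂ) : center G F x ∈ std G F := by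
  intro a
  have h : ∀ b ∈ comp G F a, center G F x b =
      x b - ((comp G F a).card : ℂ)⁻¹ * ∑ c ∈ comp G F a, x c := by
    intro b hb
    rw [center_apply, ← comp_eq (mem_comp.1 hb)]
  rw [Finset.sum_congr rfl h, Finset.sum_sub_distrib, Finset.sum_const, nsmul_eq_mul,
    mul_inv_cancel_left₀ (card_comp_ne_zero F a), sub_self]

/-- `center G F` is the identity on `std G F`. -/
theorem center_of_mem {F : Finset E(G)} {x : V(G) → ℂ} (hx : x ∈ std G F) :
    center G F x = x := by
  ext a
  rw [center_apply, hx a, mul_zero, sub_zero]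

/-- `center G F` vanishes on the vectors that are constant on the components of `F`. -/
theorem center_of_const {F : Finset E(G)} {x : V(G) → ℂ}
    (hx : ∀ a b, conn G F a b → x b = x a) : center G F x = 0 := by
  ext a
  rw [center_apply, Finset.sum_congr rfl fun b hb => hx a b (mem_comp.1 hb), Finset.sum_const,
    nsmul_eq_mul, inv_mul_cancel_left₀ (card_comp_ne_zero F a), sub_self, Pi.zero_apply]

theorem center_center {F F' : Finset E(G)} (h : F' ⊆ F) (x : V(G) → ℂ) :
    center G F' (center G F x) = center G F' x := by
  have hc : center G F' (x - center G F x) = 0 := by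
    refine center_of_const fun a b hab => ?_
    simp only [Pi.sub_apply, center_apply, comp_eq (conn_mono h hab)]
    ring
  rw [map_sub, sub_eq_zero] at hc
  exact hc.symm

variable (G)

/-- The projection `std G F → std G F'`.  If `F' ⊆ F`, then `std G F'` is contained in
`std G F`, and the kernel is spanned by the vectors of `std G F` that are constant on the
components of `F'`. -/
def stdProj (F F' : Finset E(G)) : std G F →ₗ[ℂ] std G F' :=
  ((center G F').codRestrict (std G F') (center_mem F')).comp (std G F).subtype

variable {G}

theorem stdProj_comp {F F' : Finset E(G)} (F'' : Finset E(G)) (h : F'' ⊆ F') :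
    (stdProj G F' F'').comp (stdProj G F F') = stdProj G F F'' := by
  ext x : 2
  exact center_center h (x : V(G) → ℂ)

theorem stdProj_comm {F F' : Finset E(G)} (h : F' ⊆ F) (σ : young G F') :
    (stdProj G F F').comp (stdRep G F ⟨σ, young_mono h σ.2⟩) =
      (stdRep G F' σ).comp (stdProj G F F') := by
  ext x a
  have hσ := (σ⁻¹).2
  have hc : comp G F' (((σ⁻¹ : young G F') : Equiv.Perm V(G)) a) = comp G F' a :=
    (comp_eq (hσ a)).symm
  change _ - _ * ∑ b ∈ comp G F' a, (x : V(G) → ℂ) (((σ⁻¹ : young G F') : Equiv.Perm V(G)) b) =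
    _ - ((comp G F' (((σ⁻¹ : young G F') : Equiv.Perm V(G)) a)).card : ℂ)⁻¹ *
      ∑ b ∈ comp G F' (((σ⁻¹ : young G F') : Equiv.Perm V(G)) a), (x : V(G) → ℂ) b
  rw [sum_comp_young hσ, hc]
  rfl

/-- The map of modules over the Young subgroup of `F'` that determines the per-edge map:
`⋀^j` of the projection `stdProj G F F'`. -/
def extProj (F F' : Finset E(G)) (j : ℕ) : extModule G F j →ₗ[ℂ] extModule G F' j :=
  exteriorPower.map j (stdProj G F F')

theorem extProj_comp {F F' : Finset E(G)} (F'' : Finset E(G)) (h : F'' ⊆ F') (j : ℕ)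
    (y : extModule G F j) :
    extProj F' F'' j (extProj F F' j y) = extProj F F'' j y := by
  rw [extProj, extProj, ← LinearMap.comp_apply, ← exteriorPower.map_comp, stdProj_comp F'' h]
  rfl

theorem extProj_comm {F F' : Finset E(G)} (h : F' ⊆ F) (j : ℕ) (σ : young G F')
    (y : extModule G F j) :
    extProj F F' j (extRep G F j ⟨σ, young_mono h σ.2⟩ y) =
      extRep G F' j σ (extProj F F' j y) := by
  change exteriorPower.map j _ (exteriorPower.map j _ y) =
    exteriorPower.map j _ (exteriorPower.map j _ y)
  rw [← LinearMap.comp_apply, ← LinearMap.comp_apply, ← exteriorPower.map_comp,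
    ← exteriorPower.map_comp, stdProj_comm h]

/-- The per-edge map `ℳ_F → ℳ_{F'}` in degree `j`, used for `F' = F - e`.  It corresponds under
Frobenius reciprocity to `extProj F F' j`.

If the ends of `e` lie in one component of `F'`, then `F` and `F'` have the same components,
`stdProj G F F'` is the identity, and so is the per-edge map.  If removing `e` splits a
component into `A` and `B`, then `std G F = 𝒯 ⊕ 𝟏` over the Young subgroup of `F'`, where
`𝒯 = std G F'` and `𝟏` is spanned by `|B| 1_A - |A| 1_B`.  So
`⋀^* (std G F) = ⋀^* 𝒯 ⊕ (⋀^* 𝒯)[1]`, and `extProj` is the identity on the first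
summand and zero on the second. -/
def perEdge {F F' : Finset E(G)} (h : F' ⊆ F) (j : ℕ) :
    (stateRep G F j).IntertwiningMap (stateRep G F' j) where
  toLinearMap := ((extProj F F' j).compLeft (Equiv.Perm V(G))).restrict fun f hf σ τ => by
    change extProj F F' j (f ((σ : Equiv.Perm V(G)) * τ)) = extRep G F' j σ (extProj F F' j (f τ))
    rw [← extProj_comm h, ← hf ⟨σ, young_mono h σ.2⟩ τ]
    rfl
  isIntertwining' _ := by ext : 3; rfl

theorem perEdge_apply {F F' : Finset E(G)} (h : F' ⊆ F) (j : ℕ) (f : stateModule G F j)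
    (τ : Equiv.Perm V(G)) :
    (perEdge h j f : Equiv.Perm V(G) → extModule G F' j) τ =
      extProj F F' j ((f : Equiv.Perm V(G) → extModule G F j) τ) := rfl

theorem perEdge_perEdge {F F' F'' : Finset E(G)} (h : F' ⊆ F) (h' : F'' ⊆ F') (j : ℕ)
    (f : stateModule G F j) :
    perEdge h' j (perEdge h j f) = perEdge (h'.trans h) j f := by
  ext τ : 2
  exact extProj_comp F'' h' j _

end PerEdge

section Complex

open CategoryTheory CategoryTheory.Limits

attribute [local instance] HasFiniteBiproducts.of_hasFiniteProducts

variable {α : Type u} {β : Type v} (G : Graph α β)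

/-- The states of `G` with `i` edges. -/
abbrev State (i : ℕ) : Type v := {F : Finset E(G) // F.card = i}

variable {G} in
/-- The state `F - e`. -/
def State.remove [LinearOrder E(G)] {i : ℕ} (F : State G (i + 1)) (e : {e // e ∈ F.1}) :
    State G i :=
  ⟨F.1.erase e, by rw [Finset.card_erase_of_mem e.2, F.2, Nat.add_sub_cancel]⟩

variable {G} in
theorem State.remove_subset [LinearOrder E(G)] {i : ℕ} (F : State G (i + 1))
    (e : {e // e ∈ F.1}) : (F.remove e).1 ⊆ F.1 := Finset.erase_subset _ _

/-- The sign `(-1)^k` of the per-edge map for the removal of `e` from the state `F`, where `k` is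
the number of edges after `e` in the enumeration of `E(G)` that do not belong to `F`. -/
def sgn [Fintype E(G)] [LinearOrder E(G)] (F : Finset E(G)) (e : E(G)) : ℤ :=
  (-1) ^ (Finset.univ.filter fun e' => e < e' ∧ e' ∉ F).card

variable [Fintype V(G)]

/-- `(ℳ_F)_j` as an object of the category of representations of the symmetric group on `V(G)`. -/
def stateObj (F : Finset E(G)) (j : ℕ) : Rep.{u} ℂ (Equiv.Perm V(G)) := 
  Rep.coind (young G F).subtype (Rep.of (extRep G F j))

variable {G} in
/-- The per-edge map as a morphism of representations. -/
def perEdgeHom {F F' : Finset E(G)} (h : F' ⊆ F) (j : ℕ) : stateObj G F j ⟶ stateObj G F' j :=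
  Rep.ofHom (perEdge h j)

variable {G} in
theorem perEdgeHom_comp {F F' F'' : Finset E(G)} (h : F' ⊆ F) (h' : F'' ⊆ F') (j : ℕ) :
    perEdgeHom h j ≫ perEdgeHom h' j = perEdgeHom (h'.trans h) j :=
  Rep.hom_ext (Representation.IntertwiningMap.ext (LinearMap.ext fun f => perEdge_perEdge h h' j f))

variable [Fintype E(G)]

/-- The chain module `C_{i,j}(G) = ⨁_{|F| = i} (ℳ_F)_j`. -/
def chain (i j : ℕ) : Rep.{u} ℂ (Equiv.Perm V(G)) := ⨁ fun F : State G i => stateObj G F.1 j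

/-- The inclusion of the summand indexed by the state `F`. -/
def chainι {i : ℕ} (F : State G i) (j : ℕ) : stateObj G F.1 j ⟶ chain G i j :=
  biproduct.ι (fun F : State G i => stateObj G F.1 j) F

variable {G} in
theorem chain_hom_ext {i j : ℕ} {X : Rep.{u} ℂ (Equiv.Perm V(G))} (f g : chain G i j ⟶ X)
    (h : ∀ F : State G i, chainι G F j ≫ f = chainι G F j ≫ g) : f = g :=
  biproduct.hom_ext' f g h

variable {G} in
theorem perEdgeHom_chainι_congr {i : ℕ} (j : ℕ) {F : Finset E(G)} {F₁ F₂ : State G i}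
    (h₁ : F₁.1 ⊆ F) (h₂ : F₂.1 ⊆ F) (h : F₁ = F₂) :
    perEdgeHom h₁ j ≫ chainι G F₁ j = perEdgeHom h₂ j ≫ chainι G F₂ j := by
  subst h; rfl

variable [LinearOrder E(G)]

/-- The differential `d_{i+1,j} : C_{i+1,j}(G) → C_{i,j}(G)`, the sum of the signed per-edge
maps. -/
def diff (i j : ℕ) : chain G (i + 1) j ⟶ chain G i j :=
  biproduct.desc fun F : State G (i + 1) =>
    ∑ e : {e // e ∈ F.1}, sgn G F.1 e • perEdgeHom (F.remove_subset e) j ≫ chainι G (F.remove e) j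

theorem chainι_diff {i : ℕ} (F : State G (i + 1)) (j : ℕ) :
    chainι G F j ≫ diff G i j = ∑ e : {e // e ∈ F.1},
      sgn G F.1 e • perEdgeHom (F.remove_subset e) j ≫ chainι G (F.remove e) j :=
  biproduct.ι_desc _ _

variable {G} in
theorem sgn_erase_of_lt {F : Finset E(G)} {e f : E(G)} (hf : f ∈ F) (h : e < f) :
    sgn G (F.erase f) e = -sgn G F e := by
  have : (Finset.univ.filter fun e' => e < e' ∧ e' ∉ F.erase f) =
      insert f (Finset.univ.filter fun e' => e < e' ∧ e' ∉ F) := by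
    ext x
    simp only [Finset.mem_filter, Finset.mem_univ, true_and, Finset.mem_erase, Finset.mem_insert]
    by_cases hx : x = f
    · subst hx; simp [h]
    · simp [hx]
  rw [sgn, sgn, this, Finset.card_insert_of_notMem (by simp [hf]), pow_succ, mul_neg_one]

variable {G} in
theorem sgn_erase_of_gt {F : Finset E(G)} {e f : E(G)} (h : f < e) :
    sgn G (F.erase f) e = sgn G F e := by
  have : (Finset.univ.filter fun e' => e < e' ∧ e' ∉ F.erase f) =
      (Finset.univ.filter fun e' => e < e' ∧ e' ∉ F) := by
    ext x
    simp only [Finset.mem_filter, Finset.mem_univ, true_and, Finset.mem_erase]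
    by_cases hx : x = f
    · subst hx; simp [h.not_gt]
    · simp [hx]
  rw [sgn, sgn, this]

variable {G} in
theorem sgn_swap {F : Finset E(G)} {e f : E(G)} (he : e ∈ F) (hf : f ∈ F) (h : e ≠ f) :
    sgn G F e * sgn G (F.erase e) f = -(sgn G F f * sgn G (F.erase f) e) := by
  rcases lt_or_gt_of_ne h with h | h
  · rw [sgn_erase_of_gt h, sgn_erase_of_lt hf h]; ring
  · rw [sgn_erase_of_gt h, sgn_erase_of_lt he h]; ring

theorem diff_comp_diff (i j : ℕ) : diff G (i + 1) j ≫ diff G i j = 0 := by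
  refine chain_hom_ext _ _ fun F => ?_
  rw [← Category.assoc, chainι_diff, comp_zero, Preadditive.sum_comp]
  have step : ∀ e : {e // e ∈ F.1},
      (sgn G F.1 e • perEdgeHom (F.remove_subset e) j ≫ chainι G (F.remove e) j) ≫ diff G i j =
      ∑ f : {f // f ∈ (F.remove e).1}, (sgn G F.1 e * sgn G (F.1.erase e) f) •
        perEdgeHom (((F.remove e).remove_subset f).trans (F.remove_subset e)) j ≫
          chainι G ((F.remove e).remove f) j := by
    intro e
    rw [Preadditive.zsmul_comp, Category.assoc, chainι_diff, Preadditive.comp_sum,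
      Finset.smul_sum]
    refine Finset.sum_congr rfl fun f _ => ?_
    rw [Preadditive.comp_zsmul, smul_smul, ← Category.assoc, perEdgeHom_comp]
    rfl
  rw [Finset.sum_congr rfl fun e _ => step e, Finset.sum_sigma']
  have mem : ∀ (e : {e // e ∈ F.1}) (f : {f // f ∈ (F.remove e).1}), f.1 ≠ e.1 ∧ f.1 ∈ F.1 :=
    fun e f => Finset.mem_erase.1 f.2
  refine Finset.sum_involution
    (fun p _ => ⟨⟨p.2.1, (mem p.1 p.2).2⟩,
      ⟨p.1.1, Finset.mem_erase.2 ⟨(mem p.1 p.2).1.symm, p.1.2⟩⟩⟩) ?_ ?_ ?_ ?_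
  · rintro ⟨e, f⟩ -
    dsimp only
    rw [sgn_swap e.2 (mem e f).2 (mem e f).1.symm, neg_smul, neg_add_eq_zero]
    congr 1
    exact perEdgeHom_chainι_congr j _ _ (Subtype.ext (Finset.erase_right_comm).symm)
  · rintro ⟨e, f⟩ - - h
    exact (mem e f).1 (congrArg (fun p => p.1.1) h)
  · intros; exact Finset.mem_univ _
  · intros; rfl

/-- The chain complex `C_{*,j}(G)` of representations of the symmetric group on `V(G)`. -/
def complex (j : ℕ) : ChainComplex (Rep.{u} ℂ (Equiv.Perm V(G))) ℕ :=
  ChainComplex.of (fun i => chain G i j) (fun i => diff G i j) (fun i => diff_comp_diff G i j)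

/-- The chromatic symmetric homology `H_{i,j}(G) = ker d_{i,j} / im d_{i+1,j}`, a representation
of the symmetric group on `V(G)`. -/
def homology (i j : ℕ) : Rep.{u} ℂ (Equiv.Perm V(G)) := (complex G j).homology i

end Complex

end ChromaticSymmetric

namespace ChromaticSymmetric

universe u v

set_option linter.unusedSectionVars false

/-! ### Per-edge maps between states with the same components -/

section SameComponents

variable {α : Type u} {β : Type v} {G : Graph α β} [Fintype V(G)]

/-! Adding or deleting a loop `l` does not change the components of a state, so the per-edge map
from `F + l` to `F` is invertible (`isIso_perEdgeHom`). Let `s` send the summand of a state `F`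
without `l` to that of `F + l` by the inverse of this map, with the sign that the differential gives
to removing `l` from `F + l`; on states containing `l`, let `s` be zero. Then `ds + sd = 1`, so each
complex is contractible and its homology vanishes.

If `l ∈ F`, only the removal of `l` contributes to `sd`, and `s` undoes it
(`chainι_contraction_diff_of_mem`). If `l ∉ F`, the removal of `l` in `ds` gives the identity, and
removing any other edge `e` cancels against the matching term of `sd`, because the signs of removing
`e` and `l` in the two orders are opposite (`chainι_contraction_diff_of_notMem`). -/

theorem conn_erase_loop [DecidableEq E(G)] {l : E(G)} {x : α} (hl : G.IsLoopAt (l : β) x)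
    (F : Finset E(G)) {a b : V(G)} (h : conn G F a b) : conn G (F.erase l) a b := by
  change Relation.EqvGen _ a b at h
  induction h with
  | rel a b h =>
    obtain ⟨e, he, hab⟩ := h
    by_cases hel : e = l
    · subst hel
      have ha : (a : α) = x := (hl.eq_of_inc hab.inc_left).symm
      have hb : (b : α) = x := (hl.eq_of_inc hab.inc_right).symm
      rw [Subtype.ext (ha.trans hb.symm)]
    · exact Relation.EqvGen.rel _ _ ⟨e, Finset.mem_erase.2 ⟨hel, he⟩, hab⟩
  | refl a => exact (conn G _).refl a
  | symm a b _ ih => exact (conn G _).symm ih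
  | trans a b c _ _ ih₁ ih₂ => exact (conn G _).trans ih₁ ih₂

variable {F F' : Finset E(G)}

theorem std_eq_of_conn_eq (h : conn G F = conn G F') : std G F = std G F' := by
  have hc : ∀ a, comp G F a = comp G F' a := fun a => by ext b; rw [mem_comp, mem_comp, h]
  ext x
  change (∀ a, _ = _) ↔ (∀ a, _ = _)
  simp only [hc]

theorem coe_stdProj_of_conn_eq (h : conn G F = conn G F') (x : std G F) :
    (stdProj G F F' x : V(G) → ℂ) = x :=
  center_of_mem (std_eq_of_conn_eq h ▸ x.2)

/-- The two modules are equal only propositionally, so "the per-edge map is the identity" is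
expressed by mutually inverse projections. -/
theorem extProj_extProj_of_conn_eq (h : conn G F = conn G F') (j : ℕ) (y : extModule G F j) :
    extProj F' F j (extProj F F' j y) = y := by
  have hid : (stdProj G F' F).comp (stdProj G F F') = LinearMap.id := by
    refine LinearMap.ext fun x => Subtype.ext ?_
    exact (coe_stdProj_of_conn_eq h.symm _).trans (coe_stdProj_of_conn_eq h x)
  rw [extProj, extProj, ← LinearMap.comp_apply, ← exteriorPower.map_comp, hid,
    exteriorPower.map_id, LinearMap.id_apply]

/-- The inverse of the per-edge map between states with the same components. -/
def perEdgeInv (h : F' ⊆ F) (hc : conn G F = conn G F') (j : ℕ) :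
    (stateRep G F' j).IntertwiningMap (stateRep G F j) where
  toLinearMap := ((extProj F' F j).compLeft (Equiv.Perm V(G))).restrict fun f hf σ τ => by
    have hσ : (σ : Equiv.Perm V(G)) ∈ young G F' := fun a => hc ▸ σ.2 a
    change extProj F' F j (f ((σ : Equiv.Perm V(G)) * τ)) = extRep G F j σ (extProj F' F j (f τ))
    -- The inverse of an equivariant bijection is equivariant: equivariance of `extProj F F' j` is
    -- used at a preimage, and then `extProj F' F j` is applied to both sides.
    have key := extProj_comm h j ⟨σ, hσ⟩ (extProj F' F j (f τ))
    rw [extProj_extProj_of_conn_eq hc.symm, ← hf ⟨σ, hσ⟩ τ] at key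
    exact (congrArg (extProj F' F j) key.symm).trans (extProj_extProj_of_conn_eq hc j _)
  isIntertwining' _ := by ext : 3; rfl

theorem isIso_perEdgeHom (h : F' ⊆ F) (hc : conn G F = conn G F') (j : ℕ) :
    CategoryTheory.IsIso (perEdgeHom h j) := by
  refine ⟨Rep.ofHom (perEdgeInv h hc j), ?_, ?_⟩
  · refine Rep.hom_ext (Representation.IntertwiningMap.ext (LinearMap.ext fun f => ?_))
    exact Subtype.ext (funext fun τ => extProj_extProj_of_conn_eq hc j _)
  · refine Rep.hom_ext (Representation.IntertwiningMap.ext (LinearMap.ext fun f => ?_))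
    exact Subtype.ext (funext fun τ => extProj_extProj_of_conn_eq hc.symm j _)

end SameComponents

/-! ### The contracting homotopy and the vanishing of homology -/

section Contraction

open CategoryTheory CategoryTheory.Limits

attribute [local instance] HasFiniteBiproducts.of_hasFiniteProducts

variable {α : Type u} {β : Type v} {G : Graph α β} [Fintype V(G)] [Fintype E(G)]
  [LinearOrder E(G)]

theorem sgn_mul_self (F : Finset E(G)) (e : E(G)) : sgn G F e * sgn G F e = 1 := by
  rw [sgn, ← mul_pow]; simp

/-- The state `F + l`. -/
def State.add {i : ℕ} (F : State G i) {l : E(G)} (hl : l ∉ F.1) : State G (i + 1) :=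
  ⟨insert l F.1, by rw [Finset.card_insert_of_notMem hl, F.2]⟩

theorem State.mem_add {i : ℕ} (F : State G i) {l : E(G)} (hl : l ∉ F.1) : l ∈ (F.add hl).1 :=
  Finset.mem_insert_self _ _

theorem State.subset_add {i : ℕ} (F : State G i) {l : E(G)} (hl : l ∉ F.1) :
    F.1 ⊆ (F.add hl).1 := Finset.subset_insert _ _

theorem State.add_remove {i : ℕ} (F : State G i) {l : E(G)} (hl : l ∉ F.1) :
    (F.add hl).remove ⟨l, F.mem_add hl⟩ = F :=
  Subtype.ext (Finset.erase_insert hl)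

theorem conn_add_loop {l : E(G)} {x : α} (hx : G.IsLoopAt (l : β) x) {i : ℕ} (F : State G i)
    (hl : l ∉ F.1) : conn G (F.add hl).1 = conn G F.1 := by
  ext a b
  refine ⟨fun h => ?_, conn_mono (F.subset_add hl)⟩
  have := conn_erase_loop hx _ h
  rwa [show (F.add hl).1.erase l = F.1 from Finset.erase_insert hl] at this

variable (l : E(G)) (hx : ∃ x, G.IsLoopAt (l : β) x)

theorem isIso_perEdgeHom_add (hx : ∃ x, G.IsLoopAt (l : β) x) {i : ℕ} (F : State G i)
    (hl : l ∉ F.1) (j : ℕ) : IsIso (perEdgeHom (F.subset_add hl) j) :=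
  isIso_perEdgeHom _ (conn_add_loop hx.choose_spec F hl) j

open Classical in
/-- The component at the state `F` of the contracting homotopy given by adding the loop `l`. -/
def addLoop (j : ℕ) {i : ℕ} (F : State G i) : stateObj G F.1 j ⟶ chain G (i + 1) j :=
  if hl : l ∉ F.1 then
    haveI := isIso_perEdgeHom_add l hx F hl j
    sgn G (F.add hl).1 l • inv (perEdgeHom (F.subset_add hl) j) ≫ chainι G (F.add hl) j
  else 0

/-- The contracting homotopy of the chromatic complex given by adding the loop `l`. -/
def contraction (i j : ℕ) : chain G i j ⟶ chain G (i + 1) j :=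
  biproduct.desc fun F => addLoop l hx j F

theorem chainι_contraction {i : ℕ} (F : State G i) (j : ℕ) :
    chainι G F j ≫ contraction l hx i j = addLoop l hx j F :=
  biproduct.ι_desc _ _

theorem addLoop_of_mem {i : ℕ} {F : State G i} (hl : l ∈ F.1) (j : ℕ) :
    addLoop l hx j F = 0 := dif_neg (not_not.2 hl)

/-- The map from `H` to `F` factors through `K`, and its last leg cancels the inverse in `addLoop`.
Keeping `K` a variable lets it be `(F + l) - e`, which equals `(F - e) + l` only propositionally. -/
theorem perEdgeHom_addLoop {i : ℕ} {H : Finset E(G)} (F : State G i) (K : State G (i + 1))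
    (hl : l ∉ F.1) (hK : K.1 = insert l F.1) (hF : F.1 ⊆ H) (hKH : K.1 ⊆ H) (j : ℕ) :
    perEdgeHom hF j ≫ addLoop l hx j F = sgn G K.1 l • perEdgeHom hKH j ≫ chainι G K j := by
  obtain rfl : K = F.add hl := Subtype.ext hK
  have := isIso_perEdgeHom_add l hx F hl j
  rw [addLoop, dif_pos hl, Preadditive.comp_zsmul, ← perEdgeHom_comp hKH (F.subset_add hl),
    Category.assoc, IsIso.hom_inv_id_assoc]

theorem addLoop_diff {i : ℕ} (F : State G i) (hl : l ∉ F.1) (j : ℕ) :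
    perEdgeHom (F.subset_add hl) j ≫ addLoop l hx j F ≫ diff G i j =
      sgn G (F.add hl).1 l • chainι G (F.add hl) j ≫ diff G i j := by
  have := isIso_perEdgeHom_add l hx F hl j
  rw [addLoop, dif_pos hl, Preadditive.zsmul_comp, Preadditive.comp_zsmul, Category.assoc,
    IsIso.hom_inv_id_assoc]

theorem sum_mem_add {M : Type*} [AddCommMonoid M] {i : ℕ} (F : State G i) {l : E(G)}
    (hl : l ∉ F.1) (f : {e // e ∈ (F.add hl).1} → M) :
    ∑ e, f e = f ⟨l, F.mem_add hl⟩ + ∑ e : {e // e ∈ F.1}, f ⟨e.1, F.subset_add hl e.2⟩ := by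
  exact ((Finset.subtypeInsertEquivOption hl).symm.sum_comp f).symm.trans (Fintype.sum_option _)

theorem chainι_contraction_diff_of_notMem {i : ℕ} (F : State G (i + 1)) (hl : l ∉ F.1) (j : ℕ) :
    chainι G F j ≫ (diff G i j ≫ contraction l hx i j +
      contraction l hx (i + 1) j ≫ diff G (i + 1) j) = chainι G F j := by
  have := isIso_perEdgeHom_add l hx F hl j
  -- Precomposing with the isomorphism from `F + l` to `F` clears the inverse, so that every term
  -- becomes a map out of the summand of `F + l`.
  rw [← cancel_epi (perEdgeHom (F.subset_add hl) j), Preadditive.comp_add, Preadditive.comp_add,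
    ← Category.assoc (chainι G F j) (contraction l hx _ j), chainι_contraction, addLoop_diff,
    ← Category.assoc (chainι G F j), chainι_diff, chainι_diff, sum_mem_add, smul_add, smul_smul,
    sgn_mul_self, one_smul, add_left_comm,
    perEdgeHom_chainι_congr j _ (F.subset_add hl) (F.add_remove hl), add_eq_left,
    Preadditive.sum_comp, Preadditive.comp_sum, Finset.smul_sum, ← Finset.sum_add_distrib]
  refine Finset.sum_eq_zero fun e _ => ?_
  have hel : e.1 ≠ l := fun h => hl (h ▸ e.2)
  have hle : l ∉ (F.remove e).1 := fun h => hl (F.remove_subset e h)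
  have hK : ((F.add hl).remove ⟨e.1, F.subset_add hl e.2⟩).1 = insert l (F.remove e).1 :=
    Finset.erase_insert_of_ne hel.symm
  have hs := sgn_swap (F.subset_add hl e.2) (F.mem_add hl) hel
  rw [show (F.add hl).1.erase l = F.1 from Finset.erase_insert hl] at hs
  have hs' : sgn G F.1 e * sgn G ((F.add hl).1.erase e.1) l =
      -(sgn G (F.add hl).1 l * sgn G (F.add hl).1 e) := by
    -- Multiply `hs` by the two signs attached to `l`; both square to `1`.
    linear_combination (sgn G (F.add hl).1 l * sgn G ((F.add hl).1.erase e.1) l) * hs +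
      (-sgn G F.1 e * sgn G ((F.add hl).1.erase e.1) l) * sgn_mul_self (F.add hl).1 l -
      (sgn G (F.add hl).1 l * sgn G (F.add hl).1 e) *
        sgn_mul_self ((F.add hl).1.erase e.1) l
  rw [Preadditive.zsmul_comp, Category.assoc, chainι_contraction, Preadditive.comp_zsmul,
    ← Category.assoc, perEdgeHom_comp,
    perEdgeHom_addLoop l hx (F.remove e) _ hle hK _ (State.remove_subset _ _), smul_smul, smul_smul]
  rw [show sgn G ((F.add hl).remove ⟨e.1, F.subset_add hl e.2⟩).1 l =
    sgn G ((F.add hl).1.erase e.1) l from rfl, hs', neg_smul, neg_add_cancel]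

theorem chainι_contraction_diff_of_mem {i : ℕ} (F : State G (i + 1)) (hl : l ∈ F.1) (j : ℕ) :
    chainι G F j ≫ (diff G i j ≫ contraction l hx i j +
      contraction l hx (i + 1) j ≫ diff G (i + 1) j) = chainι G F j := by
  rw [Preadditive.comp_add, ← Category.assoc (chainι G F j) (contraction l hx _ j),
    chainι_contraction, addLoop_of_mem l hx hl, zero_comp, add_zero, ← Category.assoc, chainι_diff,
    Preadditive.sum_comp, Finset.sum_eq_single ⟨l, hl⟩]
  · rw [Preadditive.zsmul_comp, Category.assoc, chainι_contraction,
      perEdgeHom_addLoop l hx _ F (Finset.notMem_erase l F.1) (Finset.insert_erase hl).symm _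
        (Finset.Subset.refl F.1), smul_smul, sgn_mul_self, one_smul]
    -- An idempotent isomorphism is the identity.
    have hid : perEdgeHom (Finset.Subset.refl F.1) j = 𝟙 (stateObj G F.1 j) := by
      have := isIso_perEdgeHom (Finset.Subset.refl F.1) rfl j
      rw [← cancel_epi (perEdgeHom (Finset.Subset.refl F.1) j), perEdgeHom_comp, Category.comp_id]
    rw [hid, Category.id_comp]
  · intro e _ he
    have hle : l ∈ (F.remove e).1 :=
      Finset.mem_erase.2 ⟨fun h => he (Subtype.ext h.symm), hl⟩
    rw [Preadditive.zsmul_comp, Category.assoc, chainι_contraction, addLoop_of_mem l hx hle,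
      comp_zero, smul_zero]
  · exact fun h => (h (Finset.mem_univ _)).elim

theorem diff_contraction_add (i j : ℕ) :
    diff G i j ≫ contraction l hx i j + contraction l hx (i + 1) j ≫ diff G (i + 1) j =
      𝟙 (chain G (i + 1) j) := by
  refine chain_hom_ext _ _ fun F => ?_
  rw [Category.comp_id]
  by_cases hl : l ∈ F.1
  · exact chainι_contraction_diff_of_mem l hx F hl j
  · exact chainι_contraction_diff_of_notMem l hx F hl j

/-- The only state here is empty, so after adding `l` the sole edge to remove is `l` itself and no
cross terms arise. -/
theorem contraction_zero_diff (j : ℕ) :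
    contraction l hx 0 j ≫ diff G 0 j = 𝟙 (chain G 0 j) := by
  refine chain_hom_ext _ _ fun F => ?_
  have hF : F.1 = ∅ := Finset.card_eq_zero.1 F.2
  have hl : l ∉ F.1 := by simp [hF]
  have : IsEmpty {e // e ∈ F.1} := ⟨fun e => by simpa [hF] using e.2⟩
  have := isIso_perEdgeHom_add l hx F hl j
  rw [← cancel_epi (perEdgeHom (F.subset_add hl) j), Category.comp_id,
    ← Category.assoc (chainι _ _ _), chainι_contraction, addLoop_diff, chainι_diff, sum_mem_add, Fintype.sum_empty, add_zero,
    smul_smul, sgn_mul_self, one_smul]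
  exact perEdgeHom_chainι_congr j _ _ (F.add_remove hl)

/-- The components of `contraction` as maps between terms of the chromatic complex. -/
def complexContraction (j i k : ℕ) (h : (ComplexShape.down ℕ).Rel k i) :
    (complex G j).X i ⟶ (complex G j).X k :=
  -- The relation unfolds to `i + 1 = k`; when `k` is literally `i + 1`, the transport disappears by
  -- definition.
  Eq.rec (motive := fun k _ => (complex G j).X i ⟶ (complex G j).X k) (contraction l hx i j)
    (show i + 1 = k from h)

theorem complex_d (i j : ℕ) : (complex G j).d (i + 1) i = diff G i j :=
  ChainComplex.of_d (fun i => chain G i j) (fun i => diff G i j) i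

theorem id_complex_eq (j : ℕ) :
    𝟙 (complex G j) = Homotopy.nullHomotopicMap' (complexContraction l hx j) := by
  ext1 i
  rcases i with _ | i
  · have h : (ComplexShape.down ℕ).Rel 1 0 := rfl
    -- No differential leaves degree `0`, so only the term `ds` remains.
    refine Eq.trans ?_ (Homotopy.nullHomotopicMap'_f_of_not_rel_left h
      (fun k hk => Nat.succ_ne_zero k hk) _).symm
    rw [complex_d]
    exact (contraction_zero_diff l hx j).symm
  · have h₁ : (ComplexShape.down ℕ).Rel (i + 1 + 1) (i + 1) := rfl
    have h₀ : (ComplexShape.down ℕ).Rel (i + 1) i := rfl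
    refine Eq.trans ?_ (Homotopy.nullHomotopicMap'_f h₁ h₀ _).symm
    rw [complex_d, complex_d]
    exact (diff_contraction_add l hx i j).symm

/-- The identity of the chromatic complex of a graph with a loop is null-homotopic. -/
def homotopyIdZero (j : ℕ) : Homotopy (𝟙 (complex G j)) 0 :=
  (Homotopy.ofEq (id_complex_eq l hx j)).trans (Homotopy.nullHomotopy' _)

/-- Homotopic chain maps agree on homology, so there the identity equals zero. -/
theorem isZero_homology (l : E(G)) (hx : ∃ x, G.IsLoopAt (l : β) x) (i j : ℕ) :
    IsZero (homology G i j) := by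
  rw [IsZero.iff_id_eq_zero]
  have h := (homotopyIdZero l hx j).homologyMap_eq i
  rwa [HomologicalComplex.homologyMap_id, HomologicalComplex.homologyMap_zero] at h

end Contraction

end ChromaticSymmetric

open scoped Graph in
theorem proposition3p1 {α : Type*} {β : Type*} (G : Graph α β) [Fintype V(G)] [Fintype E(G)]
    [LinearOrder E(G)] (hloop : ∃ (e : β) (a : α), G.IsLoopAt e a) (i j : ℕ) :
    CategoryTheory.Limits.IsZero (ChromaticSymmetric.homology G i j) := by
  obtain ⟨e, a, h⟩ := hloop
  exact ChromaticSymmetric.isZero_homology ⟨e, h.edge_mem⟩ ⟨a, h⟩ i j
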